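/- Let $\alpha_3,\alpha_4,\beta_1,\beta_2,\beta_3,\beta_4\in\mathbb C$ and $m\in\mathbb Z\setminus\{0\}$ satisfy $\bar\alpha_3\alpha_4-\bar\alpha_4\alpha_3=m\beta_2$, with $\beta_1,\beta_2$ linearly independent over $\mathbb R$, and put $\alpha_1=\alpha_2=0$. Let $G$ be the group of affine transformations of $\mathbb C^2$ generated by $$g_j(z_1,z_2)=(z_1+\alpha_j,\; z_2+\bar\alpha_j z_1+\beta_j),\qquad j=1,2,3,4,$$ let $S=\mathbb C^2/G$ be the corresponding primary Kodaira surface, and set $\Gamma_\alpha=\mathbb Z\alpha_3+\mathbb Z\alpha_4$, $\Gamma_\beta=\mathbb Z\beta_1+\mathbb Z\beta_2$. Let $\sigma:S\to S$ be an antiholomorphic involution and let $\tilde\sigma:\mathbb C^2\to\mathbb C^2$ be any lift of $\sigma$ to the universal covering $\mathbb C^2\to S$ (a continuous map compatible with $\sigma$ and the projection). Then $\tilde\sigma$ is a (real) affine transformation of $\mathbb C^2\cong\mathbb R^4$. More precisely, there are $c,f,d,g\in\mathbb C$ such that $$\tilde\sigma\begin{pmatrix}z_1\\z_2\end{pmatrix}=\begin{pmatrix}c&0\\f&1\end{pmatrix}\begin{pmatrix}\bar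 z_1\\\bar z_2\end{pmatrix}+\begin{pmatrix}d\\g\end{pmatrix}\quad\text{for all }(z_1,z_2)\in\mathbb C^2,$$ and $|c|=1$, $c\bar f+f=c\bar d+d\in\Gamma_\alpha$, $\bar\Gamma_\beta=\Gamma_\beta$ and $c\,\bar\Gamma_\alpha=\Gamma_\alpha$. -/

import Mathlib

open scoped Manifold ContDiff ComplexConjugate

noncomputable section

namespace Kodaira

/-- The affine transformation `(z₁, z₂) ↦ (z₁ + a, z₂ + ā z₁ + b)` of `ℂ²`. -/
def affineMap (a b : ℂ) : Equiv.Perm (ℂ × ℂ) where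
  toFun z := (z.1 + a, z.2 + conj a * z.1 + b)
  invFun z := (z.1 - a, z.2 - conj a * (z.1 - a) - b)
  left_inv z := by ext <;> simp; ring
  right_inv z := by ext <;> simp; ring

/-- The parameters of a primary Kodaira surface in Kodaira's normal form (with `α₁ = α₂ = 0`). -/
structure Data where
  (α₃ α₄ β₁ β₂ β₃ β₄ : ℂ)
  m : ℤ
  m_ne_zero : m ≠ 0
  commutator_eq : conj α₃ * α₄ - conj α₄ * α₃ = m * β₂
  linearIndependent : LinearIndependent ℝ ![β₁, β₂]

namespace Data

variable (D : Data)

/-- The group `G` of affine transformations of `ℂ²` generated by `g₁, g₂, g₃, g₄`. -/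
def G : Subgroup (Equiv.Perm (ℂ × ℂ)) :=
  Subgroup.closure
    {affineMap 0 D.β₁, affineMap 0 D.β₂, affineMap D.α₃ D.β₃, affineMap D.α₄ D.β₄}

/-- The lattice `Γ_α = ℤ α₃ + ℤ α₄`. -/
def Γα : AddSubgroup ℂ := AddSubgroup.closure {D.α₃, D.α₄}

/-- The lattice `Γ_β = ℤ β₁ + ℤ β₂`. -/
def Γβ : AddSubgroup ℂ := AddSubgroup.closure {D.β₁, D.β₂}

end Data

/-- `p : ℂ² → S` exhibits the complex manifold `S` as the quotient `ℂ²/G`: it is a surjective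
local biholomorphism whose fibres are exactly the orbits of `G`. -/
structure IsQuotientMap (D : Data) {S : Type*} [TopologicalSpace S] [ChartedSpace (ℂ × ℂ) S]
    (p : ℂ × ℂ → S) : Prop where
  surjective : Function.Surjective p
  isLocalDiffeomorph : IsLocalDiffeomorph 𝓘(ℂ, ℂ × ℂ) 𝓘(ℂ, ℂ × ℂ) ω p
  fibre_iff : ∀ x y : ℂ × ℂ, p x = p y ↔ ∃ g ∈ D.G, g x = y

/-- A self-map of a complex surface is antiholomorphic if it is continuous and, in any two charts
`φ`, `ψ` of the atlas, the complex conjugate of `ψ ∘ σ ∘ φ⁻¹` is holomorphic where it is defined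
(`star` is complex conjugation in both coordinates of `ℂ²`). -/
def IsAntiholomorphic {S : Type*} [TopologicalSpace S] [ChartedSpace (ℂ × ℂ) S]
    (σ : S → S) : Prop :=
  Continuous σ ∧ ∀ φ ∈ atlas (ℂ × ℂ) S, ∀ ψ ∈ atlas (ℂ × ℂ) S,
    DifferentiableOn ℂ (fun w => star (ψ (σ (φ.symm w))))
      {w | w ∈ φ.target ∧ σ (φ.symm w) ∈ ψ.source}

end Kodaira

end

noncomputable section

namespace Kodaira

/-! ### Entire functions that are quasi-periodic with respect to a lattice -/

section Entire

variable {ω₁ ω₂ : ℂ}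

/-! Two lifts of one map differ by an element of `G` (`exists_eq_comp`), so for each `g ∈ G` there
is `g' ∈ G` with `τ ∘ g = g' ∘ τ`. The conjugates of the coordinates of `τ` are entire functions
`F₁`, `F₂` whose increments under the generators are thereby controlled. Constant increments along a
lattice make the derivative doubly periodic, so Liouville makes `F₁`, and then `F₂`, affine along
vertical lines. Over `α₃`, `α₄` the shear `ā z₁` turns a vertical slope into an increment antilinear
in the period, which no entire function of `z₁` admits (`entire_affine_of_conj_quasiperiodic`).
Hence `F₁` has vertical slope `0`, `F₂` has slope `|C|²` where `C` is the slope of `F₁` in `z₁`, and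
`τ` is affine. Since `τ ∘ τ` lifts the identity it lies in `G`; comparing coefficients gives the
relations on `c, f, d`. -/

/-- A doubly periodic entire function is constant. -/
theorem entire_const_of_periodic (hω : LinearIndependent ℝ ![ω₁, ω₂])
    {f : ℂ → ℂ} (hf : Differentiable ℂ f)
    (h₁ : ∀ z, f (z + ω₁) = f z) (h₂ : ∀ z, f (z + ω₂) = f z) (z : ℂ) : f z = f 0 := by
  let L : PeriodPair := ⟨ω₁, ω₂, hω⟩
  refine hf.apply_eq_apply_of_bounded
    (IsZLattice.isCompact_range_of_periodic L.lattice f hf.continuous ?_).isBounded z 0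
  intro z w hw
  rw [PeriodPair.lattice] at hw
  induction hw using Submodule.span_induction generalizing z with
  | mem x hx =>
    rcases hx with rfl | rfl
    · exact h₁ z
    · exact h₂ z
  | zero => simp
  | add x y _ _ hx hy => rw [← add_assoc, hy, hx]
  | smul n x _ hx =>
    have hp : Function.Periodic f x := hx
    exact hp.zsmul n z

/-- An entire function that is additively quasi-periodic is affine. -/
theorem entire_affine_of_quasiperiodic (hω : LinearIndependent ℝ ![ω₁, ω₂])
    {f : ℂ → ℂ} (hf : Differentiable ℂ f) {k₁ k₂ : ℂ}
    (h₁ : ∀ z, f (z + ω₁) = f z + k₁) (h₂ : ∀ z, f (z + ω₂) = f z + k₂) :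
    ∃ A, ∀ z, f z = A * z + f 0 := by
  have hper : ∀ {η k : ℂ}, (∀ z, f (z + η) = f z + k) → ∀ z, deriv f (z + η) = deriv f z := by
    intro η k h z
    rw [← deriv_comp_add_const, funext h, deriv_add_const]
  have hconst := entire_const_of_periodic hω (f := deriv f) hf.deriv (hper h₁) (hper h₂)
  refine ⟨deriv f 0, fun z => ?_⟩
  have hd : Differentiable ℂ fun z => f z - deriv f 0 * z := by fun_prop
  have h0 : ∀ z, deriv (fun z => f z - deriv f 0 * z) z = 0 := fun z => by
    have := (hf z).hasDerivAt.sub ((hasDerivAt_id z).const_mul (deriv f 0))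
    have h2 := this.deriv
    simp only [mul_one, hconst z, sub_self] at h2
    exact h2
  have := is_const_of_deriv_eq_zero hd h0 z 0
  simp only [mul_zero, sub_zero] at this
  linear_combination this

/-- A complex-linear multiple of `z` that agrees on a real basis with a multiple of `z̄`
vanishes. -/
theorem coeff_eq_zero_of_conj_linear (hω : LinearIndependent ℝ ![ω₁, ω₂]) {e l : ℂ}
    (h₁ : e * ω₁ = l * conj ω₁) (h₂ : e * ω₂ = l * conj ω₂) : e = 0 ∧ l = 0 := by
  have hdet : conj ω₁ * ω₂ - conj ω₂ * ω₁ ≠ 0 := by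
    intro h
    rw [LinearIndependent.pair_iff] at hω
    have hreal : conj (conj ω₁ * ω₂) = conj ω₁ * ω₂ := by
      simp only [map_mul, Complex.conj_conj]
      linear_combination -h
    obtain ⟨r, hr⟩ := Complex.conj_eq_iff_real.1 hreal
    -- If the determinant vanishes, `ω̄₁ ω₂` is a real number `r`, and `r ω₁ = |ω₁|² ω₂` is a real
    -- dependence.
    have := hω r (-(Complex.normSq ω₁)) (by
      simp only [Complex.real_smul, Complex.ofReal_neg, Complex.normSq_eq_conj_mul_self, ← hr]
      ring)
    have h0 : ω₁ = 0 := by simpa using this.2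
    have := hω 1 0 (by simp [h0])
    simp at this
  have hl : l = 0 := by
    have : l * (conj ω₁ * ω₂ - conj ω₂ * ω₁) = 0 := by linear_combination ω₁ * h₂ - ω₂ * h₁
    exact (mul_eq_zero.1 this).resolve_right hdet
  refine ⟨?_, hl⟩
  by_contra he
  subst hl
  simp only [zero_mul, mul_eq_zero, he, false_or] at h₁ h₂
  exact hdet (by simp [h₁, h₂])

/-- An entire function whose increment along each period `ω` is `l ω̄ z + const` is affine,
and `l` vanishes. -/
theorem entire_affine_of_conj_quasiperiodic (hω : LinearIndependent ℝ ![ω₁, ω₂])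
    {f : ℂ → ℂ} (hf : Differentiable ℂ f) {l k₁ k₂ : ℂ}
    (h₁ : ∀ z, f (z + ω₁) = f z + l * conj ω₁ * z + k₁)
    (h₂ : ∀ z, f (z + ω₂) = f z + l * conj ω₂ * z + k₂) :
    l = 0 ∧ ∃ A, ∀ z, f z = A * z + f 0 := by
  have hder : ∀ {η k : ℂ}, (∀ z, f (z + η) = f z + l * conj η * z + k) →
      ∀ z, deriv f (z + η) = deriv f z + l * conj η := by
    intro η k h z
    rw [← deriv_comp_add_const, funext h, deriv_add_const]
    simpa using ((hf z).hasDerivAt.fun_add ((hasDerivAt_id z).const_mul (l * conj η))).deriv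
  obtain ⟨e, he⟩ := entire_affine_of_quasiperiodic hω hf.deriv (hder h₁) (hder h₂)
  have hl : l = 0 := by
    -- The affine function `f'` has slope `e`, so its increment along a period `ω` is both `e ω` and
    -- `l ω̄`.
    refine (coeff_eq_zero_of_conj_linear hω (e := e) ?_ ?_).2
    · have := hder h₁ 0
      rw [zero_add, he] at this
      linear_combination this
    · have := hder h₂ 0
      rw [zero_add, he] at this
      linear_combination this
  subst hl
  simp only [zero_mul, add_zero] at h₁ h₂
  exact ⟨rfl, entire_affine_of_quasiperiodic hω hf h₁ h₂⟩

end Entire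

/-! ### The group `G` -/

@[simp]
theorem affineMap_apply (a b : ℂ) (z : ℂ × ℂ) :
    affineMap a b z = (z.1 + a, z.2 + conj a * z.1 + b) := rfl

theorem continuous_affineMap (a b : ℂ) : Continuous (affineMap a b) := by
  have : ⇑(affineMap a b) = fun z : ℂ × ℂ => (z.1 + a, z.2 + conj a * z.1 + b) := rfl
  rw [this]
  fun_prop

theorem affineMap_mul (a b a' b' : ℂ) :
    affineMap a b * affineMap a' b' = affineMap (a + a') (b + b' + conj a * a') := by
  ext z <;> simp <;> ring

theorem affineMap_inv (a b : ℂ) :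
    (affineMap a b)⁻¹ = affineMap (-a) (-b + conj a * a) := by
  rw [inv_eq_iff_mul_eq_one, affineMap_mul]
  ext z <;> simp

namespace Data

variable (D : Data)

theorem det_ne_zero : conj D.α₃ * D.α₄ - conj D.α₄ * D.α₃ ≠ 0 := by
  rw [D.commutator_eq]
  have h := D.linearIndependent.ne_zero 1
  exact mul_ne_zero (Int.cast_ne_zero.2 D.m_ne_zero) (by simpa using h)

theorem linearIndependent_α : LinearIndependent ℝ ![D.α₃, D.α₄] := by
  rw [LinearIndependent.pair_iff]
  intro s t h
  simp only [Complex.real_smul] at h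
  have hc : (s : ℂ) * conj D.α₃ + t * conj D.α₄ = 0 := by
    simpa using congrArg (starRingEnd ℂ) h
  have ht : (t : ℂ) * (conj D.α₃ * D.α₄ - conj D.α₄ * D.α₃) = 0 := by
    linear_combination conj D.α₃ * h - D.α₃ * hc
  have hs : (s : ℂ) * (conj D.α₃ * D.α₄ - conj D.α₄ * D.α₃) = 0 := by
    linear_combination D.α₄ * hc - conj D.α₄ * h
  simpa [D.det_ne_zero] using And.intro hs ht

/-- The translation part, modulo `Γ_β`, of the elements of `G` over `n α₃ + k α₄`. -/
def translationPart (n k : ℤ) : ℂ :=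
  n * D.β₃ + k * D.β₄ + n * (n - 1) / 2 * (conj D.α₃ * D.α₃)
    + k * (k - 1) / 2 * (conj D.α₄ * D.α₄) + n * k * (conj D.α₃ * D.α₄)

/-- `translationPart n k` is the translation part of `g₃ⁿ g₄ᵏ`. The commutator of `g₃` and `g₄` is
the central translation by `m β₂`, so reordering a word costs only an element of `Γ_β`. -/
theorem exists_normalForm_of_mem {g : Equiv.Perm (ℂ × ℂ)} (hg : g ∈ D.G) :
    ∃ n k : ℤ, ∃ γ ∈ D.Γβ,
      g = affineMap (n * D.α₃ + k * D.α₄) (D.translationPart n k + γ) := by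
  have hβ₁ : D.β₁ ∈ D.Γβ := AddSubgroup.subset_closure (by simp)
  have hβ₂ : D.β₂ ∈ D.Γβ := AddSubgroup.subset_closure (by simp)
  have hcomm := D.commutator_eq
  induction hg using Subgroup.closure_induction with
  | mem x hx =>
    rcases hx with rfl | rfl | rfl | rfl
    · exact ⟨0, 0, _, hβ₁, by simp [translationPart]⟩
    · exact ⟨0, 0, _, hβ₂, by simp [translationPart]⟩
    · exact ⟨1, 0, 0, zero_mem _, by simp [translationPart]⟩
    · exact ⟨0, 1, 0, zero_mem _, by simp [translationPart]⟩
  | one =>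
    refine ⟨0, 0, 0, zero_mem _, ?_⟩
    ext z <;> simp [translationPart]
  | mul x y _ _ hx hy =>
    obtain ⟨n, k, γ, hγ, rfl⟩ := hx
    obtain ⟨n', k', γ', hγ', rfl⟩ := hy
    -- Moving `g₃ⁿ'` to the left past `g₄ᵏ` produces `k n'` commutators.
    refine ⟨n + n', k + k', γ + γ' - (k * n' * D.m) • D.β₂,
      sub_mem (add_mem hγ hγ') (zsmul_mem hβ₂ _), ?_⟩
    rw [affineMap_mul]
    congr 1
    · push_cast; ring
    · simp only [translationPart, map_add, map_mul, map_intCast, zsmul_eq_mul]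
      push_cast
      linear_combination (-(k : ℂ) * n') * hcomm
  | inv x _ hx =>
    obtain ⟨n, k, γ, hγ, rfl⟩ := hx
    refine ⟨-n, -k, -γ - (k * n * D.m) • D.β₂,
      sub_mem (neg_mem hγ) (zsmul_mem hβ₂ _), ?_⟩
    rw [affineMap_inv]
    congr 1
    · push_cast; ring
    · simp only [translationPart, map_add, map_mul, map_intCast, zsmul_eq_mul]
      push_cast
      linear_combination (-(k : ℂ) * n) * hcomm

theorem exists_affineMap_of_mem {g : Equiv.Perm (ℂ × ℂ)} (hg : g ∈ D.G) :
    ∃ a ∈ D.Γα, ∃ b, g = affineMap a b := by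
  obtain ⟨n, k, γ, -, rfl⟩ := D.exists_normalForm_of_mem hg
  refine ⟨_, ?_, _, rfl⟩
  have h₃ : D.α₃ ∈ D.Γα := AddSubgroup.subset_closure (by simp)
  have h₄ : D.α₄ ∈ D.Γα := AddSubgroup.subset_closure (by simp)
  simpa only [zsmul_eq_mul] using add_mem (zsmul_mem h₃ n) (zsmul_mem h₄ k)

/-- Independence of `α₃, α₄` forces `n = k = 0` in the normal form. -/
theorem mem_Γβ_of_affineMap_zero_mem {b : ℂ} (h : affineMap 0 b ∈ D.G) : b ∈ D.Γβ := by
  obtain ⟨n, k, γ, hγ, he⟩ := D.exists_normalForm_of_mem h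
  have h0 := congrArg (fun g : Equiv.Perm (ℂ × ℂ) => g 0) he
  simp only [affineMap_apply, Prod.mk.injEq, Prod.fst_zero, Prod.snd_zero, zero_add, map_zero,
    mul_zero] at h0
  obtain ⟨hα, hb⟩ := h0
  have := LinearIndependent.pair_iff.1 D.linearIndependent_α n k
    (by simpa [Complex.real_smul] using hα.symm)
  obtain ⟨rfl, rfl⟩ : n = 0 ∧ k = 0 := by exact_mod_cast this
  simpa [translationPart, hb] using hγ

theorem affineMap_zero_mem {b : ℂ} (hb : b ∈ D.Γβ) : affineMap 0 b ∈ D.G := by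
  induction hb using AddSubgroup.closure_induction with
  | mem x hx =>
    rcases hx with rfl | rfl <;> exact Subgroup.subset_closure (by simp)
  | zero =>
    convert one_mem D.G
    ext z <;> simp
  | add x y _ _ hx hy => simpa [affineMap_mul] using mul_mem hx hy
  | neg x _ hx => simpa [affineMap_inv] using inv_mem hx

theorem exists_affineMap_mem {a : ℂ} (ha : a ∈ D.Γα) : ∃ b, affineMap a b ∈ D.G := by
  induction ha using AddSubgroup.closure_induction with
  | mem x hx =>
    rcases hx with rfl | rfl
    · exact ⟨D.β₃, Subgroup.subset_closure (by simp)⟩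
    · exact ⟨D.β₄, Subgroup.subset_closure (by simp)⟩
  | zero => exact ⟨0, D.affineMap_zero_mem (zero_mem _)⟩
  | add x y _ _ hx hy =>
    obtain ⟨b, hb⟩ := hx
    obtain ⟨b', hb'⟩ := hy
    exact ⟨_, affineMap_mul x b y b' ▸ mul_mem hb hb'⟩
  | neg x _ hx =>
    obtain ⟨b, hb⟩ := hx
    exact ⟨_, affineMap_inv x b ▸ inv_mem hb⟩

theorem continuous_of_mem {g : Equiv.Perm (ℂ × ℂ)} (hg : g ∈ D.G) : Continuous g := by
  obtain ⟨a, -, b, rfl⟩ := D.exists_affineMap_of_mem hg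
  exact continuous_affineMap a b

end Data

/-! ### Lifts to the universal covering -/

section Lift

variable {D : Data} {S : Type*} [TopologicalSpace S] [ChartedSpace (ℂ × ℂ) S] {p : ℂ × ℂ → S}

/-- Two lifts of the same map differ by an element of `G`. -/
theorem IsQuotientMap.exists_eq_comp (hp : IsQuotientMap D p) {u v : ℂ × ℂ → ℂ × ℂ}
    (hu : Continuous u) (hv : Continuous v) (h : ∀ z, p (u z) = p (v z)) :
    ∃ g ∈ D.G, ∀ z, v z = g (u z) := by
  obtain ⟨g, hg, hg0⟩ := (hp.fibre_iff _ _).1 (h 0)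
  refine ⟨g, hg, fun z => ?_⟩
  -- Two lifts through a locally injective map that agree at one point of the connected space `ℂ²`
  -- agree everywhere.
  have hloc := hp.isLocalDiffeomorph.isLocalHomeomorph.isLocallyInjective
  refine congrFun ((T2Space.isSeparatedMap p).eq_of_comp_eq hloc hv
    ((D.continuous_of_mem hg).comp hu) (funext fun y => ?_) 0 hg0.symm) z
  exact (h y).symm.trans ((hp.fibre_iff _ _).2 ⟨g, hg, rfl⟩)

/-- A continuous lift of an antiholomorphic map is antiholomorphic. -/
theorem IsQuotientMap.differentiable_star_lift [IsManifold 𝓘(ℂ, ℂ × ℂ) ω S]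
    (hp : IsQuotientMap D p) {σ : S → S} (hσ : IsAntiholomorphic σ) {τ : ℂ × ℂ → ℂ × ℂ}
    (hτ : Continuous τ) (hlift : ∀ z, p (τ z) = σ (p z)) :
    Differentiable ℂ fun z => star (τ z) := by
  intro z
  have hω : (ω : WithTop ℕ∞) ≠ 0 := by simp
  set φ := chartAt (ℂ × ℂ) (p z)
  set ψ := chartAt (ℂ × ℂ) (σ (p z))
  have hpc : Continuous p := hp.isLocalDiffeomorph.contMDiff.continuous
  have hφz : p z ∈ φ.source := mem_chart_source _ _
  have hψz : σ (p z) ∈ ψ.source := mem_chart_source _ _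
  have hloc := hp.isLocalDiffeomorph (τ z)
  have hA : DifferentiableAt ℂ (fun y => φ (p y)) z := by
    have h1 : ContMDiffAt 𝓘(ℂ, ℂ × ℂ) 𝓘(ℂ, ℂ × ℂ) ω φ (p z) :=
      contMDiffOn_chart.contMDiffAt (φ.open_source.mem_nhds hφz)
    have h2 := h1.comp z (hp.isLocalDiffeomorph.contMDiff z)
    exact (contMDiffAt_iff_contDiffAt.1 h2).differentiableAt hω
  have hB : DifferentiableAt ℂ (fun w => star (ψ (σ (φ.symm w)))) (φ (p z)) := by
    refine (hσ.2 φ (chart_mem_atlas _ _) ψ (chart_mem_atlas _ _)).differentiableAt ?_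
    have hc : ContinuousAt (fun w => σ (φ.symm w)) (φ (p z)) :=
      hσ.1.continuousAt.comp (φ.continuousAt_symm (φ.map_source hφz))
    refine Filter.inter_mem (φ.open_target.mem_nhds (φ.map_source hφz))
      (hc.preimage_mem_nhds (ψ.open_source.mem_nhds ?_))
    simpa [φ.left_inv hφz] using hψz
  have hC : DifferentiableAt ℂ (fun w => hloc.localInverse (ψ.symm w)) (ψ (σ (p z))) := by
    have h1 : ContMDiffAt 𝓘(ℂ, ℂ × ℂ) 𝓘(ℂ, ℂ × ℂ) ω ψ.symm (ψ (σ (p z))) :=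
      contMDiffOn_chart_symm.contMDiffAt (ψ.open_target.mem_nhds (ψ.map_source hψz))
    have h2 : ContMDiffAt 𝓘(ℂ, ℂ × ℂ) 𝓘(ℂ, ℂ × ℂ) ω hloc.localInverse
        (ψ.symm (ψ (σ (p z)))) := by
      rw [ψ.left_inv hψz, ← hlift]
      exact hloc.localInverse_contMDiffAt
    exact (contMDiffAt_iff_contDiffAt.1 (h2.comp _ h1)).differentiableAt hω
  have hB' : DifferentiableAt ℂ (fun y => star (ψ (σ (φ.symm (φ (p y)))))) z :=
    DifferentiableAt.comp (g := fun w => star (ψ (σ (φ.symm w)))) z hB hA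
  -- Near `z`, `τ` is a local inverse of `p` applied to `σ ∘ p`. Conjugating its holomorphic factor
  -- by `star` on both sides lets it compose with the conjugate of `σ` in charts.
  have hC' : DifferentiableAt ℂ (star ∘ (fun w => hloc.localInverse (ψ.symm w)) ∘ star)
      (star (ψ (σ (φ.symm (φ (p z)))))) := by
    rw [φ.left_inv hφz]
    exact hC.star_star
  refine (hC'.comp z hB').congr_of_eventuallyEq ?_
  have e1 : ∀ᶠ y in nhds z, p y ∈ φ.source :=
    hpc.continuousAt.preimage_mem_nhds (φ.open_source.mem_nhds hφz)
  have e2 : ∀ᶠ y in nhds z, σ (p y) ∈ ψ.source :=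
    (hσ.1.comp hpc).continuousAt.preimage_mem_nhds (ψ.open_source.mem_nhds hψz)
  have e3 : ∀ᶠ y in nhds z, hloc.localInverse (p (τ y)) = τ y :=
    hτ.continuousAt.eventually hloc.localInverse_eventuallyEq_left
  filter_upwards [e1, e2, e3] with y h1 h2 h3
  simp only [Function.comp_apply, star_star, φ.left_inv h1, ψ.left_inv h2]
  rw [← hlift, h3]

end Lift

/-! ### Equivariant antiholomorphic maps are affine -/

/-- An antiholomorphic self-map of `ℂ²` that normalizes `G` is real affine. -/
theorem exists_affine_form (D : Data) {τ : ℂ × ℂ → ℂ × ℂ}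
    (hd : Differentiable ℂ fun z => star (τ z))
    (heq : ∀ g ∈ D.G, ∃ g' ∈ D.G, ∀ z, τ (g z) = g' (τ z)) :
    ∃ c f d g : ℂ, ∀ z₁ z₂ : ℂ,
      τ (z₁, z₂) = (c * conj z₁ + d, f * conj z₁ + c * conj c * conj z₂ + g) := by
  have hequi : ∀ a b, affineMap a b ∈ D.G → ∃ a' b', ∀ z₁ z₂,
      conj (τ (z₁ + a, z₂ + conj a * z₁ + b)).1 = conj (τ (z₁, z₂)).1 + a' ∧
      conj (τ (z₁ + a, z₂ + conj a * z₁ + b)).2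
        = conj (τ (z₁, z₂)).2 + conj a' * conj (τ (z₁, z₂)).1 + b' := by
    intro a b hab
    obtain ⟨g', hg', h⟩ := heq _ hab
    obtain ⟨a', -, b', rfl⟩ := D.exists_affineMap_of_mem hg'
    refine ⟨conj a', conj b', fun z₁ z₂ => ?_⟩
    have := h (z₁, z₂)
    simp only [affineMap_apply] at this
    rw [this]
    simp
  have hd₁ : Differentiable ℂ fun z => conj (τ z).1 := hd.fst
  have hd₂ : Differentiable ℂ fun z => conj (τ z).2 := hd.snd
  generalize hF₁ : (fun z => conj (τ z).1) = F₁ at hd₁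
  generalize hF₂ : (fun z => conj (τ z).2) = F₂ at hd₂
  have hF₁' : ∀ z, conj (τ z).1 = F₁ z := fun z => congrFun hF₁ z
  have hF₂' : ∀ z, conj (τ z).2 = F₂ z := fun z => congrFun hF₂ z
  simp only [hF₁', hF₂'] at hequi
  obtain ⟨u₁, v₁, E₁⟩ := hequi 0 D.β₁ (Subgroup.subset_closure (by simp))
  obtain ⟨u₂, v₂, E₂⟩ := hequi 0 D.β₂ (Subgroup.subset_closure (by simp))
  obtain ⟨u₃, v₃, E₃⟩ := hequi D.α₃ D.β₃ (Subgroup.subset_closure (by simp))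
  obtain ⟨u₄, v₄, E₄⟩ := hequi D.α₄ D.β₄ (Subgroup.subset_closure (by simp))
  simp only [add_zero, map_zero, zero_mul] at E₁ E₂
  have hβ₁ : D.β₁ ≠ 0 := by simpa using D.linearIndependent.ne_zero 0
  have hfib : ∀ {F : ℂ × ℂ → ℂ} {k₁ k₂ : ℂ}, Differentiable ℂ F →
      (∀ z₁ z₂, F (z₁, z₂ + D.β₁) = F (z₁, z₂) + k₁) →
      (∀ z₁ z₂, F (z₁, z₂ + D.β₂) = F (z₁, z₂) + k₂) →
      ∃ q, ∀ z₁ z₂, F (z₁, z₂) = q * z₂ + F (z₁, 0) := by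
    intro F k₁ k₂ hF h₁ h₂
    -- The increment along `β₁` determines the slope, which is therefore independent of `z₁`.
    refine ⟨k₁ / D.β₁, fun z₁ z₂ => ?_⟩
    obtain ⟨A, hA⟩ := entire_affine_of_quasiperiodic D.linearIndependent
      (f := fun w => F (z₁, w)) (by fun_prop) (h₁ z₁) (h₂ z₁)
    have hk : A * D.β₁ = k₁ := by
      have := h₁ z₁ 0
      rw [zero_add, hA] at this
      linear_combination this
    rw [hA z₂, ← hk, mul_div_cancel_right₀ _ hβ₁]
  obtain ⟨k, hk⟩ := hfib hd₁ (fun z₁ z₂ => (E₁ z₁ z₂).1) (fun z₁ z₂ => (E₂ z₁ z₂).1)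
  -- The generator over `α_j` also shifts `z₂` by `ᾱ_j z₁ + β_j`; hence `l = -k`.
  obtain ⟨hk0, C, hC⟩ := entire_affine_of_conj_quasiperiodic D.linearIndependent_α
    (f := fun w => F₁ (w, 0)) (by fun_prop) (l := -k) (k₁ := u₃ - k * D.β₃) (k₂ := u₄ - k * D.β₄)
    (fun z => by have := (E₃ z 0).1; rw [hk] at this; linear_combination this)
    (fun z => by have := (E₄ z 0).1; rw [hk] at this; linear_combination this)
  obtain rfl : k = 0 := neg_eq_zero.1 hk0
  have hF : ∀ z₁ z₂, F₁ (z₁, z₂) = C * z₁ + F₁ (0, 0) := fun z₁ z₂ => by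
    rw [hk, hC z₁]; ring
  have hu₁ : u₁ = 0 := by
    have := (E₁ 0 0).1
    rw [hF] at this
    linear_combination -this
  have hu₂ : u₂ = 0 := by
    have := (E₂ 0 0).1
    rw [hF] at this
    linear_combination -this
  have hu₃ : u₃ = C * D.α₃ := by
    have := (E₃ 0 0).1
    rw [hF] at this
    linear_combination -this
  have hu₄ : u₄ = C * D.α₄ := by
    have := (E₄ 0 0).1
    rw [hF] at this
    linear_combination -this
  subst hu₁ hu₂ hu₃ hu₄
  simp only [map_zero, zero_mul, add_zero] at E₁ E₂
  obtain ⟨q, hq⟩ := hfib hd₂ (fun z₁ z₂ => (E₁ z₁ z₂).2) (fun z₁ z₂ => (E₂ z₁ z₂).2)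
  -- The `z`-coefficient combines the `C C̄` coming from `g'` with the vertical shift times the
  -- slope `q`; its vanishing gives `q = C C̄`.
  have key : ∀ {a b v : ℂ}, (∀ z₁ z₂, F₂ (z₁ + a, z₂ + conj a * z₁ + b)
      = F₂ (z₁, z₂) + conj (C * a) * F₁ (z₁, z₂) + v) →
      ∀ z, F₂ (z + a, 0) = F₂ (z, 0) + (C * conj C - q) * conj a * z
        + (conj (C * a) * F₁ (0, 0) + v - q * b) := by
    intro a b v h z
    have := h z 0
    rw [hq, hF, map_mul] at this
    rw [map_mul]
    linear_combination this
  obtain ⟨hq0, A, hA⟩ := entire_affine_of_conj_quasiperiodic D.linearIndependent_α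
    (f := fun w => F₂ (w, 0)) (by fun_prop)
    (key fun z₁ z₂ => (E₃ z₁ z₂).2) (key fun z₁ z₂ => (E₄ z₁ z₂).2)
  refine ⟨conj C, conj A, conj (F₁ (0, 0)), conj (F₂ (0, 0)), fun z₁ z₂ => Prod.ext ?_ ?_⟩
  · apply (starRingEnd ℂ).injective
    rw [hF₁', hF]
    simp
  · apply (starRingEnd ℂ).injective
    rw [hF₂', hq, hA]
    simp only [map_add, map_mul, Complex.conj_conj]
    linear_combination (-z₂) * hq0

/-- The real affine self-map `(z₁, z₂) ↦ (c z̄₁ + d, f z̄₁ + z̄₂ + g)` of `ℂ²`. -/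
def conjAffineMap (c f d g : ℂ) : (ℂ × ℂ) →ᵃ[ℝ] (ℂ × ℂ) where
  toFun z := (c * conj z.1 + d, f * conj z.1 + conj z.2 + g)
  linear :=
    { toFun := fun z => (c * conj z.1, f * conj z.1 + conj z.2)
      map_add' := fun x y => by ext <;> simp <;> ring
      map_smul' := fun r x => by ext <;> simp <;> ring }
  map_vadd' z v := by ext <;> simp <;> ring

theorem image_eq_of_involutive {X : Type*} {u : X → X} {s : Set X} (hu : Function.Involutive u)
    (h : ∀ x ∈ s, u x ∈ s) : u '' s = s :=
  Set.Subset.antisymm (Set.image_subset_iff.2 h) fun x hx => ⟨u x, h x hx, hu x⟩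

end Kodaira

end

/-! ### Relations between the coefficients and the lattices. -/

theorem proposition2p1 (D : Kodaira.Data)
    {S : Type*} [TopologicalSpace S] [ChartedSpace (ℂ × ℂ) S] [IsManifold 𝓘(ℂ, ℂ × ℂ) ω S]
    (p : ℂ × ℂ → S) (hp : Kodaira.IsQuotientMap D p)
    (σ : S → S) (hσ : Kodaira.IsAntiholomorphic σ) (hinv : Function.Involutive σ)
    (τ : ℂ × ℂ → ℂ × ℂ) (hτ : Continuous τ) (hlift : ∀ z, p (τ z) = σ (p z)) :
    (∃ A : (ℂ × ℂ) ≃ᵃ[ℝ] (ℂ × ℂ), ⇑A = τ) ∧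
    ∃ c f d g : ℂ,
      (∀ z₁ z₂ : ℂ, τ (z₁, z₂) = (c * conj z₁ + d, f * conj z₁ + conj z₂ + g)) ∧
      ‖c‖ = 1 ∧
      c * conj f + f = c * conj d + d ∧
      c * conj d + d ∈ D.Γα ∧
      (fun w : ℂ => conj w) '' (D.Γβ : Set ℂ) = (D.Γβ : Set ℂ) ∧
      (fun w : ℂ => c * conj w) '' (D.Γα : Set ℂ) = (D.Γα : Set ℂ) := by
  have hcov : ∀ g ∈ D.G, ∃ g' ∈ D.G, ∀ z, τ (g z) = g' (τ z) := fun g hg =>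
    hp.exists_eq_comp hτ (hτ.comp (D.continuous_of_mem hg)) fun z => by
      rw [hlift, hlift, (hp.fibre_iff z (g z)).2 ⟨g, hg, rfl⟩]
  obtain ⟨g₀, hg₀, hsq⟩ := hp.exists_eq_comp continuous_id (hτ.comp hτ) fun z => by
    rw [Function.comp_apply, hlift, hlift, hinv, id]
  obtain ⟨a₀, ha₀, b₀, rfl⟩ := D.exists_affineMap_of_mem hg₀
  obtain ⟨c, f, d, g, hform⟩ := Kodaira.exists_affine_form D
    (hp.differentiable_star_lift hσ hτ hlift) hcov
  simp only [Function.comp_apply, id, Prod.forall, hform, Kodaira.affineMap_apply,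
    Prod.mk.injEq, map_add, map_mul, Complex.conj_conj] at hsq
  have h00 := hsq 0 0
  -- Subtracting the values at `(0, 0)` isolates the coefficients of `z₁`.
  have h10 := hsq 1 0
  simp only [mul_zero, mul_one, zero_add, add_zero] at h00 h10
  have hcc : c * conj c = 1 := by linear_combination h10.1 - h00.1
  have hcd : c * conj d + d = a₀ := h00.1
  have hcf : c * conj f + f = a₀ := by
    have h : f * conj c + conj f = conj a₀ := by
      linear_combination h10.2 - h00.2 - conj f * hcc
    have h' := congrArg (starRingEnd ℂ) h
    simp only [map_add, map_mul, Complex.conj_conj] at h'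
    linear_combination h'
  have hτform : ∀ z₁ z₂ : ℂ,
      τ (z₁, z₂) = (c * conj z₁ + d, f * conj z₁ + conj z₂ + g) := fun z₁ z₂ => by
    rw [hform, hcc, one_mul]
  -- Passing from `g` to `g'` acts on `Γ_α` by `a ↦ c ā` and on vertical translations by `b ↦ b̄`.
  -- Both are involutions, so inclusion of the image suffices for equality.
  have himage : ∀ a b, Kodaira.affineMap a b ∈ D.G → ∃ b', c * conj a ∈ D.Γα ∧
      Kodaira.affineMap (c * conj a) b' ∈ D.G ∧ (a = 0 → b' = conj b) := by
    intro a b hab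
    obtain ⟨g', hg', h⟩ := hcov _ hab
    obtain ⟨a', ha', b', rfl⟩ := D.exists_affineMap_of_mem hg'
    have h0 := h (0, 0)
    simp only [Kodaira.affineMap_apply, hτform, Prod.mk.injEq, map_zero, mul_zero,
      zero_add, add_zero] at h0
    obtain rfl : a' = c * conj a := by linear_combination -h0.1
    refine ⟨b', ha', hg', ?_⟩
    rintro rfl
    simp only [map_zero, mul_zero, zero_mul, zero_add, add_zero] at h0
    linear_combination -h0.2
  have hbij : Function.Bijective τ := by
    have hττ : ∀ z, τ (τ z) = Kodaira.affineMap a₀ b₀ z := fun z => by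
      have := hsq z.1 z.2
      rw [Kodaira.affineMap_apply, ← Prod.mk.eta (p := z), hform, hform]
      simpa only [Prod.mk.injEq, map_add, map_mul, Complex.conj_conj] using this
    have hb : Function.Bijective (τ ∘ τ) := by
      rw [show τ ∘ τ = Kodaira.affineMap a₀ b₀ from funext hττ]
      exact Equiv.bijective _
    exact ⟨hb.1.of_comp, hb.2.of_comp⟩
  have hA : ⇑(Kodaira.conjAffineMap c f d g) = τ := funext fun z => (hτform z.1 z.2).symm
  refine ⟨⟨AffineEquiv.ofBijective (φ := Kodaira.conjAffineMap c f d g) (hA ▸ hbij), hA⟩,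
    c, f, d, g, hτform, ?_, hcf.trans hcd.symm, hcd ▸ ha₀, ?_, ?_⟩
  · have : ‖c‖ * ‖c‖ = 1 := by simpa using congrArg norm hcc
    nlinarith [norm_nonneg c]
  · refine Kodaira.image_eq_of_involutive (fun w => Complex.conj_conj w) fun b hb => ?_
    obtain ⟨b', -, hmem, hb'⟩ := himage 0 b (D.affineMap_zero_mem hb)
    rw [hb' rfl, map_zero, mul_zero] at hmem
    exact D.mem_Γβ_of_affineMap_zero_mem hmem
  · refine Kodaira.image_eq_of_involutive (fun w => ?_) fun a ha => ?_
    · simp only [map_mul, Complex.conj_conj]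
      linear_combination w * hcc
    · obtain ⟨b, hb⟩ := D.exists_affineMap_mem ha
      exact (himage a b hb).choose_spec.1
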